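/- For an integer $N\ge 1$ let $\ell^2_N$ be $\mathbb C^N$ with its standard Hilbert space structure, and for $p\in\{1,2\}$ let $\mathcal S^p_N$ be the space $B(\ell^2_N)$ with the Schatten $p$-norm $\|X\|_p=(\sum_i s_i(X)^p)^{1/p}$, where $s_i(X)$ are the singular values of $X$. For normal operators $U_0,U_1,U_2\in B(\ell^2_N)$ with spectral decompositions $U_l=\sum_{i=1}^N z^{(l)}_iP^{(l)}_i$ (where $P^{(l)}_i$ is the orthogonal projection onto the span of the $i$-th vector of an orthonormal basis of eigenvectors of $U_l$, with eigenvalue $z^{(l)}_i$) and a function $\psi$ defined on the product of their spectra, let $$T_\psi^{U_0,U_1,U_2}(X,Y)=\sum_{i,j,k=1}^N\psi\bigl(z^{(0)}_i,z^{(1)}_k,z^{(2)}_j\bigr)P^{(0)}_iXP^{(1)}_kYP^{(2)}_j,\qquad X,Y\in B(\ell^2_N).$$ Let $h\colon\mathbb R\to\mathbb R$ be a $2\pi$-periodic $C^1$-function that is $C^2$ on $\mathbb R\setminus 2\pi\mathbb Z$ and satisfies $h(0)=0$ and $$h(x)=|x|\Bigl(\log\Bigl|\log\frac{|x|}{e}\Bigr|\Bigr)^{-1/2}\qquad\text{for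 } 0<|x|\le e^{-1}.$$ Let $\mathbb T=\{z\in\mathbb C:|z|=1\}$, let $g\colon\mathbb T\to\mathbb C$ be the function with $g(e^{i\theta})=h(\theta)$ for $\theta\in\mathbb R$, and let $f(z)=(z-1)g(z)$ for $z\in\mathbb T$; then $f\in C^2(\mathbb T)$. Let $f^{[1]}(z_0,z_1)=\frac{f(z_0)-f(z_1)}{z_0-z_1}$ if $z_0\ne z_1$ and $f^{[1]}(z_0,z_0)=f'(z_0)$; let $f^{[2]}(z_0,z_1,z_2)=\frac{f^{[1]}(z_0,z_1)-f^{[1]}(z_1,z_2)}{z_0-z_2}$ if $z_0\neq z_2$ and $f^{[2]}(z_0,z_1,z_0)=\frac{d}{dz}f^{[1]}(z,z_1)\big|_{z=z_0}$, where derivatives are taken along $\mathbb T$, i.e. $\frac{d}{dz}\varphi(z)|_{z=z_0}=\lim_{\mathbb T\ni z\to z_0}\frac{\varphi(z)-\varphi(z_0)}{z-z_0}$. Put $\varsigma(z_0,z_1,z_2)=z_1f^{[2]}(z_0,z_1,z_2)$ on $\mathbb T^3$. Then there is a constant $c>0$ such that for every $n\ge 3$ there exist unitary operators $H_n,K_n\in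 B(\ell^2_{2n+1})$ with $\sigma(H_n)=\sigma(K_n)$ and $$\bigl\|T_\varsigma^{K_n,H_n,H_n}\colon\mathcal S^2_{2n+1}\times\mathcal S^2_{2n+1}\to\mathcal S^1_{2n+1}\bigr\|\ \ge\ c\,(\log n)^{1/2},$$ where the norm is the supremum of $\|T_\varsigma^{K_n,H_n,H_n}(X,Y)\|_1$ over all $X,Y$ with $\|X\|_2\le1$ and $\|Y\|_2\le 1$. -/

import Mathlib

open scoped ENNReal

noncomputable section

namespace TripleOperatorIntegral

/-- The Hilbert space `ℓ²_N`. -/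
abbrev Ell2 (N : ℕ) : Type := EuclideanSpace ℂ (Fin N)

/-- The algebra `B(ℓ²_N)` of operators on `ℓ²_N`. -/
abbrev Op (N : ℕ) : Type := Ell2 N →L[ℂ] Ell2 N

/-- The Schatten `p`-norm (`1 ≤ p < ∞`): the `ℓ^p`-norm of the sequence of singular values. -/
def schattenNorm {N : ℕ} (p : ℝ) (X : Op N) : ℝ :=
  (∑ i ∈ Finset.range N, (X.toLinearMap.singularValues i) ^ p) ^ (1 / p)

/-- The set of eigenvalues of an operator on `ℓ²_N`, as a type. -/
abbrev Eig {N : ℕ} (U : Op N) : Type := Module.End.Eigenvalues U.toLinearMap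

/-- The spectral projection of a normal operator at `z`, that is, the orthogonal projection
onto the eigenspace of `z`. -/
def spectralProj {N : ℕ} (U : Op N) (z : ℂ) : Op N :=
  (Module.End.eigenspace U.toLinearMap z).starProjection

/-- The triple operator integral `T_ψ^{U₀,U₁,U₂}(X, Y)` of normal operators `U₀, U₁, U₂`:
`∑ ψ(z₀,z₁,z₂) E₀(z₀) X E₁(z₁) Y E₂(z₂)`, over the eigenvalues `zᵢ` of `Uᵢ`, where `Eᵢ` are the
spectral projections. See `triple_eq_sum_of_eigenbasis` for the form that uses orthonormal bases
of eigenvectors. -/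
def triple {N : ℕ} (ψ : ℂ → ℂ → ℂ → ℂ) (U₀ U₁ U₂ : Op N) (X Y : Op N) : Op N :=
  ∑ z₀ : Eig U₀, ∑ z₁ : Eig U₁, ∑ z₂ : Eig U₂,
    ψ z₀.val z₁.val z₂.val •
      (spectralProj U₀ z₀.val * X * spectralProj U₁ z₁.val * Y * spectralProj U₂ z₂.val)

/-- The norm of a (bilinear) map `S²_N × S²_N → S¹_N`: the supremum of `‖B(X, Y)‖₁` over
`‖X‖₂ ≤ 1` and `‖Y‖₂ ≤ 1`. -/
def bilinNorm {N : ℕ} (B : Op N → Op N → Op N) : ℝ≥0∞ :=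
  ⨆ (X : Op N) (Y : Op N) (_ : schattenNorm 2 X ≤ 1) (_ : schattenNorm 2 Y ≤ 1),
    ENNReal.ofReal (schattenNorm 1 (B X Y))

/-- The unit circle `𝕋 ⊆ ℂ`. Functions on `𝕋` are functions on `ℂ` of which only the values
on `𝕋` matter, and `d/dz` on `𝕋` is `derivWithin · 𝕋`. -/
def circle : Set ℂ := Metric.sphere 0 1

open Classical in
/-- The divided difference of first order of a function on `𝕋`. -/
def divDiff₁ (f : ℂ → ℂ) (z₀ z₁ : ℂ) : ℂ :=
  if z₀ ≠ z₁ then (f z₀ - f z₁) / (z₀ - z₁) else derivWithin f circle z₀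

open Classical in
/-- The divided difference of second order of a function on `𝕋`. -/
def divDiff₂ (f : ℂ → ℂ) (z₀ z₁ z₂ : ℂ) : ℂ :=
  if z₀ ≠ z₂ then (divDiff₁ f z₀ z₁ - divDiff₁ f z₁ z₂) / (z₀ - z₂)
  else derivWithin (fun z => divDiff₁ f z z₁) circle z₀

open Classical in
/-- `|x| (log |log (|x| / e)|)^{-1/2}`, and `0` at `x = 0`. -/
def hFormula (x : ℝ) : ℝ :=
  if x = 0 then 0
  else |x| * (Real.log |Real.log (|x| / Real.exp 1)|) ^ (-(1 / 2) : ℝ)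

/-- `h` is a `2π`-periodic `C¹` function on `ℝ` that extends `hFormula` from `[-e⁻¹, e⁻¹]` and
is `C²` away from the singular points `2πk`, `k ∈ ℤ`. -/
structure IsPeriodicExtension (h : ℝ → ℝ) : Prop where
  eq_formula : ∀ x ∈ Set.Icc (-(Real.exp 1)⁻¹) (Real.exp 1)⁻¹, h x = hFormula x
  periodic : Function.Periodic h (2 * Real.pi)
  contDiff : ContDiff ℝ 1 h
  contDiffOn : ContDiffOn ℝ 2 h {x | ∀ k : ℤ, x ≠ 2 * Real.pi * k}

/-- The function `g` on `𝕋` with `g(e^{iθ}) = h(θ)`. -/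
def gFun (h : ℝ → ℝ) (z : ℂ) : ℂ := (h z.arg : ℂ)

/-- The function `f(z) = (z - 1) g(z)` on `𝕋`. -/
def fFun (h : ℝ → ℝ) (z : ℂ) : ℂ := (z - 1) * gFun h z

/-- The function `ς(z₀, z₁, z₂) = z₁ f^{[2]}(z₀, z₁, z₂)` on `𝕋³`. -/
def sigmaFun (h : ℝ → ℝ) (z₀ z₁ z₂ : ℂ) : ℂ := z₁ * divDiff₂ (fFun h) z₀ z₁ z₂

theorem gFun_exp {h : ℝ → ℝ} (hp : Function.Periodic h (2 * Real.pi)) (θ : ℝ) :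
    gFun h (Complex.exp (θ * Complex.I)) = (h θ : ℂ) := by
  unfold gFun
  rw [Complex.arg_exp_mul_I]
  congr 1
  rw [toIocMod]
  exact hp.sub_zsmul_eq _

/-- Spectral projections in terms of an orthonormal basis of eigenvectors. -/
theorem spectralProj_eq_sum {N : ℕ} (U : Op N) (b : OrthonormalBasis (Fin N) ℂ (Ell2 N))
    (z : Fin N → ℂ) (hb : ∀ i, U (b i) = z i • b i) (w : ℂ) :
    spectralProj U w = ∑ i with z i = w, (ℂ ∙ b i).starProjection := by
  have key : ∀ j, spectralProj U w (b j) =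
      (∑ i with z i = w, (ℂ ∙ b i).starProjection) (b j) := by
    intro j
    have h1 : ∀ i, (ℂ ∙ b i).starProjection (b j) = if i = j then b j else 0 := by
      intro i
      rw [Submodule.starProjection_unit_singleton ℂ (b.norm_eq_one i)]
      rw [b.inner_eq_ite]
      split_ifs with hij
      · simp [hij]
      · simp
    rw [sum_apply]
    simp only [h1]
    rw [Finset.sum_ite_eq' _ j]
    simp only [Finset.mem_filter, Finset.mem_univ, true_and]
    split_ifs with hj
    · refine Submodule.starProjection_eq_self_iff.2 ?_
      rw [Module.End.mem_eigenspace_iff, ← hj]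
      exact hb j
    · refine (Submodule.starProjection_apply_eq_zero_iff _).2 ?_
      rw [Submodule.mem_orthogonal]
      intro v hv
      have hv' : U v = w • v := Module.End.mem_eigenspace_iff.1 hv
      have h2 : b.repr (U v) j = z j * b.repr v j := by
        conv_lhs => rw [← b.sum_repr v]
        simp [map_sum, hb, b.repr_self, Pi.single_apply, mul_comm]
      rw [hv'] at h2
      have h3 : b.repr v j = 0 := by
        by_contra h0
        apply hj
        have : w * b.repr v j = z j * b.repr v j := by simpa using h2
        exact (mul_right_cancel₀ h0 this).symm
      rw [b.repr_apply_apply] at h3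
      exact inner_eq_zero_symm.1 h3
  ext1 v
  rw [← b.sum_repr v, map_sum, map_sum]
  exact Finset.sum_congr rfl fun j _ => by rw [map_smul, map_smul, key j]

theorem sum_eig_eq_sum {N : ℕ} (U : Op N) (b : OrthonormalBasis (Fin N) ℂ (Ell2 N))
    (z : Fin N → ℂ) (hb : ∀ i, U (b i) = z i • b i) (F : ℂ → Op N → Op N)
    (hF : ∀ w (s : Finset (Fin N)) (P : Fin N → Op N), F w (∑ i ∈ s, P i) = ∑ i ∈ s, F w (P i)) :
    ∑ w : Eig U, F w.val (spectralProj U w.val) = ∑ i, F (z i) (ℂ ∙ b i).starProjection := by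
  have he : ∀ i, Module.End.HasEigenvalue U.toLinearMap (z i) := fun i =>
    Module.End.hasEigenvalue_of_hasEigenvector
      ⟨Module.End.mem_eigenspace_iff.2 (hb i), b.orthonormal.ne_zero i⟩
  let e : Fin N → Eig U := fun i => ⟨z i, he i⟩
  classical
  rw [← Finset.sum_fiberwise Finset.univ e fun i => F (z i) (ℂ ∙ b i).starProjection]
  refine Finset.sum_congr rfl fun w _ => ?_
  rw [spectralProj_eq_sum U b z hb, hF]
  refine Finset.sum_congr ?_ fun i hi => ?_
  · ext i
    simp only [Finset.mem_filter, Finset.mem_univ, true_and]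
    exact ⟨fun h => Subtype.ext h, fun h => congrArg Subtype.val h⟩
  · have hw : e i = w := (Finset.mem_filter.1 hi).2
    subst hw
    rfl

/-- For any orthonormal bases of eigenvectors of `U₀, U₁, U₂`, with eigenvalues `zᵢ⁽⁰⁾, zₖ⁽¹⁾, zⱼ⁽²⁾`
and rank one projections `Pᵢ⁽⁰⁾, Pₖ⁽¹⁾, Pⱼ⁽²⁾`, the triple operator integral is
`∑ ψ(zᵢ⁽⁰⁾, zₖ⁽¹⁾, zⱼ⁽²⁾) Pᵢ⁽⁰⁾ X Pₖ⁽¹⁾ Y Pⱼ⁽²⁾`. -/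
theorem triple_eq_sum_of_eigenbasis {N : ℕ} (ψ : ℂ → ℂ → ℂ → ℂ) (U₀ U₁ U₂ X Y : Op N)
    (b₀ b₁ b₂ : OrthonormalBasis (Fin N) ℂ (Ell2 N)) (z₀ z₁ z₂ : Fin N → ℂ)
    (h₀ : ∀ i, U₀ (b₀ i) = z₀ i • b₀ i) (h₁ : ∀ k, U₁ (b₁ k) = z₁ k • b₁ k)
    (h₂ : ∀ j, U₂ (b₂ j) = z₂ j • b₂ j) :
    triple ψ U₀ U₁ U₂ X Y = ∑ i, ∑ k, ∑ j, ψ (z₀ i) (z₁ k) (z₂ j) •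
      ((ℂ ∙ b₀ i).starProjection * X * (ℂ ∙ b₁ k).starProjection * Y *
        (ℂ ∙ b₂ j).starProjection) := by
  unfold triple
  rw [sum_eig_eq_sum U₀ b₀ z₀ h₀ fun w P => ∑ v₁ : Eig U₁, ∑ v₂ : Eig U₂,
    ψ w v₁.val v₂.val • (P * X * spectralProj U₁ v₁.val * Y * spectralProj U₂ v₂.val)]
  · refine Finset.sum_congr rfl fun i _ => ?_
    rw [sum_eig_eq_sum U₁ b₁ z₁ h₁ fun w P => ∑ v₂ : Eig U₂,
      ψ (z₀ i) w v₂.val • ((ℂ ∙ b₀ i).starProjection * X * P * Y * spectralProj U₂ v₂.val)]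
    · refine Finset.sum_congr rfl fun k _ => ?_
      rw [sum_eig_eq_sum U₂ b₂ z₂ h₂ fun w P => ψ (z₀ i) (z₁ k) w •
        ((ℂ ∙ b₀ i).starProjection * X * (ℂ ∙ b₁ k).starProjection * Y * P)]
      intro w s P
      simp only [Finset.mul_sum, Finset.smul_sum]
    · intro w s P
      simp only [Finset.mul_sum, Finset.sum_mul, Finset.smul_sum]
      exact Finset.sum_comm
  · intro w s P
    simp only [Finset.sum_mul, Finset.smul_sum]
    exact (Finset.sum_congr rfl fun v _ => Finset.sum_comm).trans Finset.sum_comm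

end TripleOperatorIntegral

end

/-
If `z₀, z₂ ≠ 1`, then `ς(z₀, 1, z₂)` is the divided difference of `g`. Evaluating the triple
operator integral at `X = x ⊗ e*` and `Y = e ⊗ y*`, with `e` an eigenvector for the eigenvalue `1`,
therefore gives the Schur product of a rank one matrix with the matrix of these divided differences.
Its trace norm is bounded below by pairing it with the finite periodic Hilbert matrix, which is a
contraction because the discrete Fourier transform turns it into the diagonal matrix of a sawtooth
function. For eigenvalues `e^{ia}` and `e^{-ib}` with `a, b ∈ {e^{-m-1}, …, e^{-m-n}}` the phases of
the divided differences can be absorbed into `x` and `y`; what remains has the sign of `a - b`, like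
the corresponding entry of the Hilbert matrix, and modulus at least of order `(log n)^{-1/2}`. So
there is no cancellation in the pairing, and the absolute values of the entries of the Hilbert
matrix have a sum of order `n log n`, while `‖x‖ ‖y‖ = n`.
-/

open scoped InnerProductSpace Matrix Matrix.Norms.L2Operator Topology

noncomputable section

namespace TripleOperatorIntegral

section Orthonormal

variable {E : Type*} [NormedAddCommGroup E] [InnerProductSpace ℂ E]

theorem starProjection_orthonormalBasis_apply {ι : Type*} [Fintype ι] [DecidableEq ι]
    (b : OrthonormalBasis ι ℂ E) (i j : ι) :
    (ℂ ∙ b i).starProjection (b j) = if i = j then b j else 0 := by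
  rw [Submodule.starProjection_unit_singleton ℂ (b.norm_eq_one i), b.inner_eq_ite]
  split_ifs with hij
  · rw [hij, one_smul]
  · rw [zero_smul]

theorem norm_toLp_inner_le {ι : Type*} [Fintype ι] {e : ι → E} (he : Orthonormal ℂ e) (x : E) :
    ‖WithLp.toLp 2 fun j => ⟪x, e j⟫_ℂ‖ ≤ ‖x‖ := by
  rw [EuclideanSpace.norm_eq]
  refine Real.sqrt_le_iff.2 ⟨norm_nonneg _, ?_⟩
  simpa only [norm_inner_symm x] using he.sum_inner_products_le x (s := Finset.univ)

theorem norm_sum_matrix_mul_inner_mul_inner_le {ι κ : Type*} [Fintype ι] [Fintype κ]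
    [DecidableEq κ] (Q : Matrix ι κ ℂ) {e : ι → E} {e' : κ → E}
    (he : Orthonormal ℂ e) (he' : Orthonormal ℂ e') (x y : E) :
    ‖∑ j, ∑ k, Q j k * (⟪e j, x⟫_ℂ * ⟪y, e' k⟫_ℂ)‖ ≤ ‖Q‖ * (‖x‖ * ‖y‖) := by
  let a : EuclideanSpace ℂ ι := WithLp.toLp 2 fun j => ⟪x, e j⟫_ℂ
  let b : EuclideanSpace ℂ κ := WithLp.toLp 2 fun k => ⟪y, e' k⟫_ℂ
  have pairing : ∑ j, ∑ k, Q j k * (⟪e j, x⟫_ℂ * ⟪y, e' k⟫_ℂ) =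
      ⟪a, WithLp.toLp 2 (Q *ᵥ b.ofLp)⟫_ℂ := by
    rw [PiLp.inner_apply]
    refine Finset.sum_congr rfl fun j _ => ?_
    simp only [a, b, RCLike.inner_apply, inner_conj_symm, Matrix.mulVec, dotProduct, Finset.sum_mul]
    exact Finset.sum_congr rfl fun k _ => by ring
  calc _ ≤ ‖a‖ * ‖WithLp.toLp 2 (Q *ᵥ b.ofLp)‖ := pairing ▸ norm_inner_le_norm _ _
    _ ≤ ‖x‖ * (‖Q‖ * ‖y‖) := by
        gcongr
        · exact norm_toLp_inner_le he x
        · exact (Matrix.l2_opNorm_mulVec Q b).trans (by gcongr; exact norm_toLp_inner_le he' y)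
    _ = ‖Q‖ * (‖x‖ * ‖y‖) := by ring

end Orthonormal

theorem exists_rightSingularBasis {N : ℕ} (Z : Op N) :
    ∃ v : OrthonormalBasis (Fin N) ℂ (Ell2 N),
      ∀ i : Fin N, ‖Z (v i)‖ = Z.toLinearMap.singularValues i := by
  have hN : Module.finrank ℂ (Ell2 N) = N := finrank_euclideanSpace_fin
  have hs := Z.toLinearMap.isSymmetric_adjoint_comp_self
  let v := hs.eigenvectorBasis hN
  refine ⟨v, fun i => ?_⟩
  have inner_eq : ⟪Z (v i), Z (v i)⟫_ℂ = ((hs.eigenvalues hN i : ℝ) : ℂ) :=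
    calc ⟪Z (v i), Z (v i)⟫_ℂ
        = ⟪v i, (Z.toLinearMap.adjoint ∘ₗ Z.toLinearMap) (v i)⟫_ℂ :=
          by rw [LinearMap.comp_apply, LinearMap.adjoint_inner_right]; rfl
      _ = ((hs.eigenvalues hN i : ℝ) : ℂ) := by
          rw [hs.apply_eigenvectorBasis hN i, inner_smul_right, inner_self_eq_norm_sq_to_K,
            v.norm_eq_one]
          simp
  have sq_eq : ‖Z (v i)‖ ^ 2 = Z.toLinearMap.singularValues i ^ 2 := by
    rw [Z.toLinearMap.sq_singularValues_fin hN]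
    rw [inner_self_eq_norm_sq_to_K] at inner_eq
    exact Complex.ofReal_injective (by push_cast; exact inner_eq)
  exact (pow_left_inj₀ (norm_nonneg _) (Z.toLinearMap.singularValues_nonneg _) two_ne_zero).1 sq_eq

theorem schattenNorm_two_rankOne {N : ℕ} (x y : Ell2 N) :
    schattenNorm 2 (InnerProductSpace.rankOne ℂ x y) = ‖x‖ * ‖y‖ := by
  obtain ⟨v, hv⟩ := exists_rightSingularBasis (InnerProductSpace.rankOne ℂ x y)
  have sum_eq : ∑ i : Fin N,
      ((InnerProductSpace.rankOne ℂ x y).toLinearMap.singularValues i : ℝ) ^ (2 : ℝ) =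
      (‖x‖ * ‖y‖) ^ 2 :=
    calc _ = ∑ i, ‖x‖ ^ 2 * ‖⟪y, v i⟫_ℂ‖ ^ 2 := by
          refine Finset.sum_congr rfl fun i _ => ?_
          rw [← hv i, Real.rpow_two, InnerProductSpace.rankOne_apply, norm_smul]
          ring
      _ = (‖x‖ * ‖y‖) ^ 2 := by
          rw [← Finset.mul_sum, v.sum_sq_norm_inner_left, mul_pow]
  rw [schattenNorm, Finset.sum_range fun i => (LinearMap.singularValues _ i : ℝ) ^ (2 : ℝ), sum_eq,
    ← Real.sqrt_eq_rpow, Real.sqrt_sq (by positivity)]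

theorem norm_sum_matrix_mul_inner_le {N : ℕ} {ι κ : Type*} [Fintype ι] [Fintype κ]
    [DecidableEq κ] (Q : Matrix ι κ ℂ) {e : ι → Ell2 N} {e' : κ → Ell2 N}
    (he : Orthonormal ℂ e) (he' : Orthonormal ℂ e') (Z : Op N) :
    ‖∑ j, ∑ k, Q j k * ⟪e j, Z (e' k)⟫_ℂ‖ ≤ ‖Q‖ * schattenNorm 1 Z := by
  obtain ⟨v, hv⟩ := exists_rightSingularBasis Z
  have entry j k : ⟪e j, Z (e' k)⟫_ℂ = ∑ i, ⟪e j, Z (v i)⟫_ℂ * ⟪v i, e' k⟫_ℂ := by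
    simpa only [ContinuousLinearMap.adjoint_inner_left] using
      (v.sum_inner_mul_inner (ContinuousLinearMap.adjoint Z (e j)) (e' k)).symm
  have expand : ∑ j, ∑ k, Q j k * ⟪e j, Z (e' k)⟫_ℂ =
      ∑ i, ∑ j, ∑ k, Q j k * (⟪e j, Z (v i)⟫_ℂ * ⟪v i, e' k⟫_ℂ) := by
    simp only [entry, Finset.mul_sum]
    exact (Finset.sum_congr rfl fun j _ => Finset.sum_comm).trans Finset.sum_comm
  rw [expand, schattenNorm, Finset.sum_range fun i => (LinearMap.singularValues _ i : ℝ) ^ (1 : ℝ)]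
  simp only [Real.rpow_one, div_one, Finset.mul_sum]
  refine (norm_sum_le _ _).trans (Finset.sum_le_sum fun i _ => ?_)
  calc _ ≤ ‖Q‖ * (‖Z (v i)‖ * ‖v i‖) :=
        norm_sum_matrix_mul_inner_mul_inner_le Q he he' _ _
    _ = ‖Q‖ * Z.toLinearMap.singularValues i := by rw [v.norm_eq_one, mul_one, hv]

section Triple

variable {N : ℕ} (ψ : ℂ → ℂ → ℂ → ℂ) {U₀ U₁ U₂ : Op N}
  {b₀ b₁ b₂ : OrthonormalBasis (Fin N) ℂ (Ell2 N)} {z₀ z₁ z₂ : Fin N → ℂ}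

theorem inner_triple_apply
    (h₀ : ∀ i, U₀ (b₀ i) = z₀ i • b₀ i) (h₁ : ∀ k, U₁ (b₁ k) = z₁ k • b₁ k)
    (h₂ : ∀ j, U₂ (b₂ j) = z₂ j • b₂ j)
    (X Y : Op N) (p q : Fin N) :
    ⟪b₀ p, triple ψ U₀ U₁ U₂ X Y (b₂ q)⟫_ℂ =
      ∑ k, ψ (z₀ p) (z₁ k) (z₂ q) * (⟪b₀ p, X (b₁ k)⟫_ℂ * ⟪b₁ k, Y (b₂ q)⟫_ℂ) := by
  have term i k j : ⟪b₀ p, (ψ (z₀ i) (z₁ k) (z₂ j) • ((ℂ ∙ b₀ i).starProjection * X *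
      (ℂ ∙ b₁ k).starProjection * Y * (ℂ ∙ b₂ j).starProjection)) (b₂ q)⟫_ℂ =
      if j = q then if i = p then
        ψ (z₀ i) (z₁ k) (z₂ j) * (⟪b₀ p, X (b₁ k)⟫_ℂ * ⟪b₁ k, Y (b₂ q)⟫_ℂ) else 0 else 0 := by
    simp only [smul_apply, mul_apply_eq_comp, inner_smul_right]
    rw [← Submodule.inner_starProjection_left_eq_right, starProjection_orthonormalBasis_apply,
      starProjection_orthonormalBasis_apply]
    split_ifs with hj hi
    · rw [Submodule.starProjection_unit_singleton ℂ (b₁.norm_eq_one k), map_smul, inner_smul_right,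
        mul_comm ⟪b₁ k, _⟫_ℂ]
    all_goals simp
  rw [triple_eq_sum_of_eigenbasis ψ U₀ U₁ U₂ X Y b₀ b₁ b₂ z₀ z₁ z₂ h₀ h₁ h₂]
  simp only [sum_apply, inner_sum, term, Finset.sum_ite_eq', Finset.mem_univ, if_true]
  rw [Finset.sum_comm]
  simp only [Finset.sum_ite_eq', Finset.mem_univ, if_true]

theorem inner_triple_rankOne_apply
    (h₀ : ∀ i, U₀ (b₀ i) = z₀ i • b₀ i) (h₁ : ∀ k, U₁ (b₁ k) = z₁ k • b₁ k)
    (h₂ : ∀ j, U₂ (b₂ j) = z₂ j • b₂ j)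
    (x y : Ell2 N) (o p q : Fin N) :
    ⟪b₀ p, triple ψ U₀ U₁ U₂ (InnerProductSpace.rankOne ℂ x (b₁ o))
      (InnerProductSpace.rankOne ℂ (b₁ o) y) (b₂ q)⟫_ℂ =
      ψ (z₀ p) (z₁ o) (z₂ q) * (⟪b₀ p, x⟫_ℂ * ⟪y, b₂ q⟫_ℂ) := by
  rw [inner_triple_apply ψ h₀ h₁ h₂, Finset.sum_eq_single o]
  · simp
  · intro k _ hk
    simp [b₁.inner_eq_zero hk.symm]
  · simp

theorem ofReal_norm_sum_matrix_mul_le_bilinNorm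
    (h₀ : ∀ i, U₀ (b₀ i) = z₀ i • b₀ i) (h₁ : ∀ k, U₁ (b₁ k) = z₁ k • b₁ k)
    (h₂ : ∀ j, U₂ (b₂ j) = z₂ j • b₂ j)
    {ι κ : Type*} [Fintype ι] [Fintype κ]
    [DecidableEq κ] {Q : Matrix ι κ ℂ} (hQ : ‖Q‖ ≤ 1) (o : Fin N)
    (f : ι ↪ Fin N) (g : κ ↪ Fin N) {x y : Ell2 N} (hx : ‖x‖ ≤ 1) (hy : ‖y‖ ≤ 1) :
    ENNReal.ofReal ‖∑ j, ∑ k, Q j k * (ψ (z₀ (f j)) (z₁ o) (z₂ (g k)) *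
      (⟪b₀ (f j), x⟫_ℂ * ⟪y, b₂ (g k)⟫_ℂ))‖ ≤ bilinNorm (triple ψ U₀ U₁ U₂) := by
  let X := InnerProductSpace.rankOne ℂ x (b₁ o)
  let Y := InnerProductSpace.rankOne ℂ (b₁ o) y
  have hX : schattenNorm 2 X ≤ 1 := by
    rwa [schattenNorm_two_rankOne, b₁.norm_eq_one, mul_one]
  have hY : schattenNorm 2 Y ≤ 1 := by
    rwa [schattenNorm_two_rankOne, b₁.norm_eq_one, one_mul]
  have duality := norm_sum_matrix_mul_inner_le Q (b₀.orthonormal.comp f f.injective)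
    (b₂.orthonormal.comp g g.injective) (triple ψ U₀ U₁ U₂ X Y)
  simp only [Function.comp_apply, X, Y, inner_triple_rankOne_apply ψ h₀ h₁ h₂] at duality
  refine (ENNReal.ofReal_le_ofReal (duality.trans ?_)).trans
    (le_iSup₂_of_le X Y (le_iSup₂_of_le hX hY le_rfl))
  exact mul_le_of_le_one_left (Real.rpow_nonneg (Finset.sum_nonneg fun i _ =>
    Real.rpow_nonneg (LinearMap.singularValues_nonneg _ i) _) _) hQ

end Triple

theorem exists_unitary_apply_eq_smul {N : ℕ} (z : Fin N → ℂ) (hz : ∀ i, ‖z i‖ = 1) :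
    ∃ U ∈ unitary (Op N), ∀ i, U (EuclideanSpace.basisFun (Fin N) ℂ i) =
      z i • EuclideanSpace.basisFun (Fin N) ℂ i := by
  have diagonal_mem : Matrix.diagonal z ∈ Matrix.unitaryGroup (Fin N) ℂ := by
    rw [Matrix.mem_unitaryGroup_iff', Matrix.star_eq_conjTranspose, Matrix.diagonal_conjTranspose,
      Matrix.diagonal_mul_diagonal, ← Matrix.diagonal_one]
    congr 1
    ext i
    simp [RCLike.conj_mul, hz i]
  refine ⟨Matrix.toEuclideanCLM (𝕜 := ℂ) (Matrix.diagonal z),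
    Unitary.map_mem (Matrix.toEuclideanCLM (n := Fin N) (𝕜 := ℂ)) diagonal_mem, fun i => ?_⟩
  ext j
  rcases eq_or_ne j i with rfl | hji
  · simp [Matrix.mulVec_diagonal]
  · simp [Matrix.mulVec_diagonal, hji]

theorem exp_mul_I_sub_exp_mul_I (s t : ℝ) :
    Complex.exp (s * Complex.I) - Complex.exp (t * Complex.I) =
      Complex.exp (((s + t) / 2 : ℝ) * Complex.I) *
        (2 * Complex.I * (Real.sin ((s - t) / 2) : ℂ)) := by
  have two_sin := Complex.two_sin (((s - t) / 2 : ℝ) : ℂ)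
  have hs : (s : ℂ) * Complex.I =
      ((s + t) / 2 : ℝ) * Complex.I + ((s - t) / 2 : ℝ) * Complex.I := by
    push_cast; ring
  have ht : (t : ℂ) * Complex.I =
      ((s + t) / 2 : ℝ) * Complex.I + -((s - t) / 2 : ℝ) * Complex.I := by
    push_cast; ring
  rw [hs, ht, Complex.exp_add, Complex.exp_add, Complex.ofReal_sin, mul_right_comm 2, two_sin]
  linear_combination -Complex.exp (((s + t) / 2 : ℝ) * Complex.I) *
    (Complex.exp (-((s - t) / 2 : ℝ) * Complex.I) -
      Complex.exp (((s - t) / 2 : ℝ) * Complex.I)) * Complex.I_sq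

theorem sigmaFun_one (h : ℝ → ℝ) {z w : ℂ} (hz : z ≠ 1) (hw : w ≠ 1) (hzw : z ≠ w) :
    sigmaFun h z 1 w = (gFun h z - gFun h w) / (z - w) := by
  have left : divDiff₁ (fFun h) z 1 = gFun h z := by
    rw [divDiff₁, if_pos hz, fFun, fFun, sub_self, zero_mul, sub_zero,
      mul_div_cancel_left₀ _ (sub_ne_zero.2 hz)]
  have right : divDiff₁ (fFun h) 1 w = gFun h w := by
    rw [divDiff₁, if_pos hw.symm, fFun, fFun, sub_self, zero_mul, zero_sub, ← neg_mul, neg_sub,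
      mul_div_cancel_left₀ _ (sub_ne_zero.2 hw.symm)]
  rw [sigmaFun, divDiff₂, if_pos hzw, left, right, one_mul]

/-- The difference quotient of `h` at the angles `s` and `t` with respect to the signed length
`2 sin ((s - t) / 2)` of the chord between `e^{is}` and `e^{it}`. -/
def chordSlope (h : ℝ → ℝ) (s t : ℝ) : ℝ := (h s - h t) / (2 * Real.sin ((s - t) / 2))

theorem exp_mul_sigmaFun_one (h : ℝ → ℝ) {s t : ℝ} (hs : s ∈ Set.Ioc (-Real.pi) Real.pi)
    (ht : t ∈ Set.Ioc (-Real.pi) Real.pi) (hs₀ : s ≠ 0) (ht₀ : t ≠ 0) (hst : s ≠ t) :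
    Complex.exp (((s + t) / 2 : ℝ) * Complex.I) *
      sigmaFun h (Complex.exp (s * Complex.I)) 1 (Complex.exp (t * Complex.I)) =
        -Complex.I * chordSlope h s t := by
  have arg_exp {u : ℝ} (hu : u ∈ Set.Ioc (-Real.pi) Real.pi) :
      (Complex.exp (u * Complex.I)).arg = u := by
    rw [Complex.arg_exp_mul_I, toIocMod_eq_self]
    exact ⟨hu.1, by linarith [hu.2]⟩
  have exp_ne_one {u : ℝ} (hu : u ∈ Set.Ioc (-Real.pi) Real.pi) (hu₀ : u ≠ 0) :
      Complex.exp (u * Complex.I) ≠ 1 := fun e => hu₀ (by rw [← arg_exp hu, e, Complex.arg_one])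
  have exp_ne : Complex.exp (s * Complex.I) ≠ Complex.exp (t * Complex.I) := fun e =>
    hst (by rw [← arg_exp hs, e, arg_exp ht])
  rw [sigmaFun_one h (exp_ne_one hs hs₀) (exp_ne_one ht ht₀) exp_ne, gFun, gFun, arg_exp hs,
    arg_exp ht, exp_mul_I_sub_exp_mul_I, mul_div_assoc',
    mul_div_mul_left _ _ (Complex.exp_ne_zero _), chordSlope, ← Complex.inv_I]
  push_cast
  ring

section HilbertMatrix

theorem sum_exp_odd_mul (n : ℕ) (t : ℝ) :
    2 * Complex.I * (Real.sin t : ℂ) *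
      ∑ l ∈ Finset.range n, Complex.exp (((2 * l + 1) * t : ℝ) * Complex.I) =
        Complex.exp ((2 * n * t : ℝ) * Complex.I) - 1 := by
  have step (l : ℕ) : 2 * Complex.I * (Real.sin t : ℂ) *
      Complex.exp (((2 * l + 1) * t : ℝ) * Complex.I) =
        Complex.exp ((2 * (l + 1 : ℕ) * t : ℝ) * Complex.I) -
          Complex.exp ((2 * l * t : ℝ) * Complex.I) := by
    have midpoint : (2 * (l + 1 : ℕ) * t + 2 * l * t) / 2 = (2 * l + 1) * t := by push_cast; ring
    have half_gap : (2 * (l + 1 : ℕ) * t - 2 * l * t) / 2 = t := by push_cast; ring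
    rw [exp_mul_I_sub_exp_mul_I, midpoint, half_gap, mul_comm]
  rw [Finset.mul_sum, Finset.sum_congr rfl fun l _ => step l,
    Finset.sum_range_sub fun l : ℕ => Complex.exp ((2 * l * t : ℝ) * Complex.I)]
  simp

theorem sum_exp_odd_mul_eq_zero {n : ℕ} {t : ℝ} (ht : Real.sin t ≠ 0)
    (hnt : Complex.exp ((2 * n * t : ℝ) * Complex.I) = 1) :
    ∑ l ∈ Finset.range n, Complex.exp (((2 * l + 1) * t : ℝ) * Complex.I) = 0 := by
  have telescoped := sum_exp_odd_mul n t
  rw [hnt, sub_self] at telescoped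
  have : 2 * Complex.I * (Real.sin t : ℂ) ≠ 0 :=
    mul_ne_zero (mul_ne_zero two_ne_zero Complex.I_ne_zero) (Complex.ofReal_ne_zero.2 ht)
  exact (mul_eq_zero_iff_left this).1 telescoped

theorem sum_mul_exp_odd_mul (n : ℕ) (t : ℝ) :
    2 * Complex.I * (Real.sin t : ℂ) *
      ∑ l ∈ Finset.range n, (l : ℂ) * Complex.exp (((2 * l + 1) * t : ℝ) * Complex.I) =
        n * Complex.exp ((2 * n * t : ℝ) * Complex.I) - Complex.exp (t * Complex.I) *
          ∑ l ∈ Finset.range n, Complex.exp (((2 * l + 1) * t : ℝ) * Complex.I) := by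
  induction n with
  | zero => simp
  | succ n ih =>
    have telescoped := sum_exp_odd_mul (n + 1) t
    have telescoped' := sum_exp_odd_mul n t
    have shift : Complex.exp ((2 * (n + 1 : ℕ) * t : ℝ) * Complex.I) =
        Complex.exp (t * Complex.I) * Complex.exp (((2 * n + 1) * t : ℝ) * Complex.I) := by
      rw [← Complex.exp_add]
      congr 1
      push_cast
      ring
    rw [Finset.sum_range_succ] at telescoped ⊢
    rw [Finset.sum_range_succ, mul_add, mul_add, ih]
    push_cast at *
    linear_combination (n : ℂ) * telescoped - n * telescoped' - shift

/-- The values at the midpoints `(2l + 1) / (2n)` of the sawtooth function `x ↦ 2 x - 1`, whose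
finite Fourier coefficients are the entries of the Hilbert matrix. -/
def sawtooth (n l : ℕ) : ℝ := (2 * l + 1 - n) / n

theorem abs_sawtooth_le_one {n l : ℕ} (hl : l < n) : |sawtooth n l| ≤ 1 := by
  have hl' : (l : ℝ) + 1 ≤ n := by exact_mod_cast hl
  rw [sawtooth, abs_div, Nat.abs_cast]
  exact div_le_one_of_le₀ (abs_le.2 ⟨by linarith [l.cast_nonneg (α := ℝ)], by linarith⟩)
    (Nat.cast_nonneg n)

theorem sum_sawtooth (n : ℕ) : ∑ l ∈ Finset.range n, sawtooth n l = 0 := by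
  have sum_id : ∀ m : ℕ, ∑ l ∈ Finset.range m, (2 * (l : ℝ) + 1) = m * m := fun m => by
    induction m with
    | zero => simp
    | succ m ih => rw [Finset.sum_range_succ, ih]; push_cast; ring
  simp only [sawtooth]
  rw [← Finset.sum_div, Finset.sum_sub_distrib, sum_id]
  simp

theorem sum_sawtooth_mul_exp {n : ℕ} {t : ℝ} (hn : n ≠ 0) (ht : Real.sin t ≠ 0)
    (hnt : Complex.exp ((2 * n * t : ℝ) * Complex.I) = 1) :
    ∑ l ∈ Finset.range n, (sawtooth n l : ℂ) *
      Complex.exp (((2 * l + 1) * t : ℝ) * Complex.I) = -Complex.I * (Real.sin t : ℂ)⁻¹ := by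
  have hn' : (n : ℂ) ≠ 0 := Nat.cast_ne_zero.2 hn
  have ht' : (Real.sin t : ℂ) ≠ 0 := Complex.ofReal_ne_zero.2 ht
  have sum_zero := sum_exp_odd_mul_eq_zero ht hnt
  have sum_mul := sum_mul_exp_odd_mul n t
  rw [hnt, sum_zero, mul_zero, sub_zero, mul_one] at sum_mul
  have split : ∑ l ∈ Finset.range n, (sawtooth n l : ℂ) *
      Complex.exp (((2 * l + 1) * t : ℝ) * Complex.I) =
        2 / n * ∑ l ∈ Finset.range n, (l : ℂ) * Complex.exp (((2 * l + 1) * t : ℝ) * Complex.I) +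
        (1 - n) / n * ∑ l ∈ Finset.range n, Complex.exp (((2 * l + 1) * t : ℝ) * Complex.I) := by
    rw [Finset.mul_sum, Finset.mul_sum, ← Finset.sum_add_distrib]
    refine Finset.sum_congr rfl fun l _ => ?_
    rw [sawtooth]
    push_cast
    ring
  rw [split, sum_zero, mul_zero, add_zero, ← Complex.inv_I]
  field_simp
  linear_combination sum_mul

/-- The finite periodic analogue of the Hilbert matrix. On the diagonal `0⁻¹ = 0`. -/
def hilbertMatrix (n : ℕ) : Matrix (Fin n) (Fin n) ℝ :=
  Matrix.of fun j k => (n * Real.sin (Real.pi * ((k : ℝ) - j) / n))⁻¹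

theorem hilbertMatrix_antisymm (n : ℕ) (j k : Fin n) :
    hilbertMatrix n k j = -hilbertMatrix n j k := by
  have : Real.pi * ((j : ℝ) - k) / n = -(Real.pi * ((k : ℝ) - j) / n) := by ring
  rw [hilbertMatrix, Matrix.of_apply, Matrix.of_apply, this, Real.sin_neg, mul_neg, inv_neg]

theorem sin_pi_mul_sub_div_pos {n : ℕ} {j k : Fin n} (hjk : j < k) :
    0 < Real.sin (Real.pi * ((k : ℝ) - j) / n) := by
  have hn : (0 : ℝ) < n := by exact_mod_cast k.pos
  have hk : ((k : ℕ) : ℝ) < n := by exact_mod_cast k.isLt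
  have hjk' : ((j : ℕ) : ℝ) < (k : ℕ) := by exact_mod_cast hjk
  refine Real.sin_pos_of_pos_of_lt_pi (div_pos (mul_pos Real.pi_pos (by linarith)) hn) ?_
  rw [div_lt_iff₀ hn]
  exact mul_lt_mul_of_pos_left (by linarith [(j : ℕ).cast_nonneg (α := ℝ)]) Real.pi_pos

theorem sin_pi_mul_sub_div_ne_zero {n : ℕ} {j k : Fin n} (hjk : j ≠ k) :
    Real.sin (Real.pi * ((k : ℝ) - j) / n) ≠ 0 := by
  rcases hjk.lt_or_gt with hlt | hgt
  · exact (sin_pi_mul_sub_div_pos hlt).ne'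
  · have : Real.pi * ((k : ℝ) - j) / n = -(Real.pi * ((j : ℝ) - k) / n) := by ring
    rw [this, Real.sin_neg]
    exact neg_ne_zero.2 (sin_pi_mul_sub_div_pos hgt).ne'

theorem exp_period_eq_one {n : ℕ} (j k : Fin n) :
    Complex.exp ((2 * n * (Real.pi * ((k : ℝ) - j) / n) : ℝ) * Complex.I) = 1 := by
  have : (n : ℂ) ≠ 0 := Nat.cast_ne_zero.2 j.pos.ne'
  rw [Complex.exp_eq_one_iff]
  refine ⟨((k : ℕ) : ℤ) - (j : ℕ), ?_⟩
  push_cast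
  field_simp

theorem inv_pi_mul_le_hilbertMatrix {n : ℕ} {j k : Fin n} (hjk : j < k) :
    Real.pi⁻¹ * |(k : ℝ) - j|⁻¹ ≤ hilbertMatrix n j k := by
  have hn : (0 : ℝ) < n := by exact_mod_cast k.pos
  have hjk' : 0 < ((k : ℕ) : ℝ) - (j : ℕ) := sub_pos.2 (by exact_mod_cast hjk)
  rw [hilbertMatrix, Matrix.of_apply, abs_of_pos hjk', ← mul_inv]
  refine inv_anti₀ (mul_pos hn (sin_pi_mul_sub_div_pos hjk)) ?_
  calc (n : ℝ) * Real.sin (Real.pi * ((k : ℝ) - j) / n)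
      ≤ n * (Real.pi * ((k : ℝ) - j) / n) := by
        gcongr
        exact Real.sin_le (by positivity)
    _ = Real.pi * ((k : ℝ) - j) := by field_simp

/-- The unitary matrix of a discrete Fourier transform with frequencies shifted by `1 / 2`. -/
def halfShiftedFourier (n : ℕ) : Matrix (Fin n) (Fin n) ℂ :=
  Matrix.of fun l j => ((√n)⁻¹ : ℂ) *
    Complex.exp (((2 * (l : ℝ) + 1) * (Real.pi * (j : ℝ) / n) : ℝ) * Complex.I)

theorem star_halfShiftedFourier_mul (n : ℕ) (l j k : Fin n) :
    star (halfShiftedFourier n l j) * halfShiftedFourier n l k =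
      (n : ℂ)⁻¹ * Complex.exp (((2 * (l : ℝ) + 1) * (Real.pi * ((k : ℝ) - j) / n) : ℝ) *
        Complex.I) := by
  have inv_sqrt : ((√n : ℂ))⁻¹ * (√n : ℂ)⁻¹ = (n : ℂ)⁻¹ := by
    rw [← mul_inv, ← Complex.ofReal_mul, Real.mul_self_sqrt n.cast_nonneg, Complex.ofReal_natCast]
  have star_exp (s : ℝ) : star (Complex.exp (s * Complex.I)) = Complex.exp (-s * Complex.I) := by
    rw [Complex.star_def, ← Complex.exp_conj]
    simp
  rw [halfShiftedFourier, Matrix.of_apply, Matrix.of_apply, star_mul', star_exp, star_inv₀,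
    Complex.star_def, Complex.conj_ofReal, mul_mul_mul_comm, inv_sqrt, ← Complex.exp_add]
  congr 2
  push_cast
  ring

theorem halfShiftedFourier_mem_unitaryGroup (n : ℕ) :
    halfShiftedFourier n ∈ Matrix.unitaryGroup (Fin n) ℂ := by
  rw [Matrix.mem_unitaryGroup_iff']
  ext j k
  simp only [Matrix.star_eq_conjTranspose, Matrix.mul_apply, Matrix.conjTranspose_apply,
    star_halfShiftedFourier_mul, ← Finset.mul_sum]
  rw [Fin.sum_univ_eq_sum_range fun l : ℕ => Complex.exp (((2 * (l : ℝ) + 1) *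
    (Real.pi * ((k : ℝ) - j) / n) : ℝ) * Complex.I)]
  rcases eq_or_ne j k with rfl | hjk
  · have : (n : ℂ) ≠ 0 := Nat.cast_ne_zero.2 j.pos.ne'
    simp [this]
  · rw [sum_exp_odd_mul_eq_zero (sin_pi_mul_sub_div_ne_zero hjk) (exp_period_eq_one j k), mul_zero,
      Matrix.one_apply_ne hjk]

theorem star_halfShiftedFourier_mul_diagonal_mul (n : ℕ) :
    star (halfShiftedFourier n) * Matrix.diagonal (fun l : Fin n => (sawtooth n l : ℂ)) *
      halfShiftedFourier n = (-Complex.I) • (hilbertMatrix n).map Complex.ofReal := by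
  ext j k
  have hn : n ≠ 0 := j.pos.ne'
  have entry : (star (halfShiftedFourier n) *
      Matrix.diagonal (fun l : Fin n => (sawtooth n l : ℂ)) * halfShiftedFourier n) j k =
      (n : ℂ)⁻¹ * ∑ l ∈ Finset.range n, (sawtooth n l : ℂ) *
        Complex.exp (((2 * (l : ℝ) + 1) * (Real.pi * ((k : ℝ) - j) / n) : ℝ) * Complex.I) := by
    rw [Matrix.mul_apply, Finset.mul_sum, ← Fin.sum_univ_eq_sum_range fun l : ℕ => (n : ℂ)⁻¹ *
      ((sawtooth n l : ℂ) * Complex.exp (((2 * (l : ℝ) + 1) *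
        (Real.pi * ((k : ℝ) - j) / n) : ℝ) * Complex.I))]
    refine Finset.sum_congr rfl fun l _ => ?_
    rw [Matrix.mul_diagonal, Matrix.star_apply, mul_right_comm, star_halfShiftedFourier_mul]
    ring
  rw [entry, Matrix.smul_apply, Matrix.map_apply, hilbertMatrix, Matrix.of_apply, smul_eq_mul]
  rcases eq_or_ne j k with rfl | hjk
  · simp [← Complex.ofReal_sum, sum_sawtooth]
  · rw [sum_sawtooth_mul_exp hn (sin_pi_mul_sub_div_ne_zero hjk) (exp_period_eq_one j k)]
    push_cast
    ring

theorem norm_hilbertMatrix_le_one (n : ℕ) : ‖(hilbertMatrix n).map Complex.ofReal‖ ≤ 1 := by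
  have hV := halfShiftedFourier_mem_unitaryGroup n
  calc ‖(hilbertMatrix n).map Complex.ofReal‖
      = ‖(-Complex.I) • (hilbertMatrix n).map Complex.ofReal‖ := by
        rw [norm_smul, norm_neg, Complex.norm_I, one_mul]
    _ = ‖Matrix.diagonal (fun l : Fin n => (sawtooth n l : ℂ))‖ := by
        rw [← star_halfShiftedFourier_mul_diagonal_mul, CStarRing.norm_mul_mem_unitary _ hV,
          CStarRing.norm_mem_unitary_mul _ (Unitary.star_mem hV)]
    _ ≤ 1 := by
        rw [Matrix.l2_opNorm_diagonal, pi_norm_le_iff_of_nonneg zero_le_one]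
        intro l
        rw [Complex.norm_real]
        exact abs_sawtooth_le_one l.isLt

end HilbertMatrix

theorem sum_inv_abs_sub_eq_harmonic_add_harmonic (j m : ℕ) :
    ∑ k ∈ Finset.range (j + 1 + m), |(k : ℝ) - j|⁻¹ = harmonic j + harmonic m := by
  have below : ∑ k ∈ Finset.range j, |(k : ℝ) - j|⁻¹ = harmonic j := by
    rw [harmonic, ← Finset.sum_range_reflect, Rat.cast_sum]
    refine Finset.sum_congr rfl fun i hi => ?_
    have dist_eq : ((j - 1 - i : ℕ) : ℝ) - j = -(i + 1) := by
      rw [Nat.sub_sub, Nat.cast_sub (by have := Finset.mem_range.1 hi; omega)]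
      push_cast
      ring
    rw [dist_eq, abs_neg, abs_of_nonneg (by positivity)]
    push_cast
    rfl
  have above : ∑ i ∈ Finset.range m, |((j + 1 + i : ℕ) : ℝ) - j|⁻¹ = harmonic m := by
    rw [harmonic, Rat.cast_sum]
    refine Finset.sum_congr rfl fun i _ => ?_
    have dist_eq : ((j + 1 + i : ℕ) : ℝ) - j = i + 1 := by push_cast; ring
    rw [dist_eq, abs_of_nonneg (by positivity)]
    push_cast
    rfl
  rw [Finset.sum_range_add, Finset.sum_range_succ, below, above, sub_self, abs_zero, inv_zero,
    add_zero]

theorem log_le_sum_inv_abs_sub {n j : ℕ} (hj : j < n) :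
    Real.log n ≤ ∑ k ∈ Finset.range n, |(k : ℝ) - j|⁻¹ := by
  obtain ⟨m, rfl⟩ := Nat.exists_eq_add_of_le (Nat.succ_le_of_lt hj)
  rw [Nat.succ_eq_add_one, sum_inv_abs_sub_eq_harmonic_add_harmonic]
  calc Real.log ((j + 1 + m : ℕ) : ℝ)
      ≤ Real.log (((j + 1 : ℕ) : ℝ) * ((m + 1 : ℕ) : ℝ)) := by
        refine Real.log_le_log (by positivity) ?_
        exact_mod_cast (by nlinarith [Nat.zero_le (j * m)] : j + 1 + m ≤ (j + 1) * (m + 1))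
    _ = Real.log ((j + 1 : ℕ) : ℝ) + Real.log ((m + 1 : ℕ) : ℝ) :=
        Real.log_mul (by positivity) (by positivity)
    _ ≤ harmonic j + harmonic m :=
        add_le_add (log_add_one_le_harmonic j) (log_add_one_le_harmonic m)

theorem le_sum_hilbertMatrix_mul {n : ℕ} {δ : ℝ} (hδ : 0 ≤ δ) {D : Fin n → Fin n → ℝ}
    (hlt : ∀ j k, j < k → δ ≤ D j k) (hgt : ∀ j k, k < j → D j k ≤ -δ) :
    δ / Real.pi * (n * Real.log n) ≤ ∑ j, ∑ k, hilbertMatrix n j k * D j k := by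
  have entry_le (j k : Fin n) (hjk : j < k) {d : ℝ} (hd : δ ≤ d) :
      δ / Real.pi * |(k : ℝ) - j|⁻¹ ≤ hilbertMatrix n j k * d :=
    calc δ / Real.pi * |(k : ℝ) - j|⁻¹ = Real.pi⁻¹ * |(k : ℝ) - j|⁻¹ * δ := by ring
      _ ≤ hilbertMatrix n j k * d :=
        mul_le_mul (inv_pi_mul_le_hilbertMatrix hjk) hd hδ
          (le_trans (by positivity) (inv_pi_mul_le_hilbertMatrix hjk))
  have term_le (j k : Fin n) : δ / Real.pi * |(k : ℝ) - j|⁻¹ ≤ hilbertMatrix n j k * D j k := by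
    rcases lt_trichotomy j k with hjk | rfl | hkj
    · exact entry_le j k hjk (hlt j k hjk)
    · simp [hilbertMatrix]
    · rw [hilbertMatrix_antisymm, neg_mul_comm, abs_sub_comm]
      exact entry_le k j hkj (le_neg_of_le_neg (hgt j k hkj))
  calc δ / Real.pi * (n * Real.log n) = ∑ _j : Fin n, δ / Real.pi * Real.log n := by
        rw [Finset.sum_const, Finset.card_univ, Fintype.card_fin, nsmul_eq_mul]
        ring
    _ ≤ ∑ j : Fin n, ∑ k : Fin n, δ / Real.pi * |(k : ℝ) - j|⁻¹ := by
        refine Finset.sum_le_sum fun j _ => ?_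
        rw [← Finset.mul_sum, Fin.sum_univ_eq_sum_range fun k : ℕ => |(k : ℝ) - (j : ℕ)|⁻¹]
        have := Real.pi_pos
        gcongr
        exact log_le_sum_inv_abs_sub j.isLt
    _ ≤ ∑ j, ∑ k, hilbertMatrix n j k * D j k :=
        Finset.sum_le_sum fun j _ => Finset.sum_le_sum fun k _ => term_le j k

theorem norm_sum_smul_le_one {E : Type*} [NormedAddCommGroup E] [InnerProductSpace ℂ E] {n : ℕ}
    {e : Fin n → E} (he : Orthonormal ℂ e) {u : Fin n → ℂ} (hu : ∀ j, ‖u j‖ ≤ (√n)⁻¹) :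
    ‖∑ j, u j • e j‖ ≤ 1 := by
  refine (sq_le_one_iff₀ (norm_nonneg _)).1 ?_
  calc ‖∑ j, u j • e j‖ ^ 2 = ∑ j, ‖u j‖ ^ 2 := by
        simpa using he.orthogonalFamily.norm_sum u Finset.univ
    _ ≤ ∑ _j : Fin n, (√n)⁻¹ ^ 2 := by gcongr with j; exact hu j
    _ = (n : ℝ) * (n : ℝ)⁻¹ := by simp [Real.sq_sqrt]
    _ ≤ 1 := mul_inv_le_one

section ChordSlope

variable (h : ℝ → ℝ) {n : ℕ} {Q : Matrix (Fin n) (Fin n) ℂ} {s t : Fin n → ℝ}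

theorem ofReal_norm_sum_chordSlope_le_bilinNorm {N : ℕ} {U : Op N}
    {b : OrthonormalBasis (Fin N) ℂ (Ell2 N)} {z : Fin N → ℂ} (hb : ∀ i, U (b i) = z i • b i)
    {o : Fin N} {f g : Fin n ↪ Fin N} (ho : z o = 1)
    (hf : ∀ j, z (f j) = Complex.exp (s j * Complex.I))
    (hg : ∀ k, z (g k) = Complex.exp (t k * Complex.I)) (hQ : ‖Q‖ ≤ 1)
    (hs : ∀ j, s j ∈ Set.Ioc (-Real.pi) Real.pi) (ht : ∀ k, t k ∈ Set.Ioc (-Real.pi) Real.pi)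
    (hs₀ : ∀ j, s j ≠ 0) (ht₀ : ∀ k, t k ≠ 0) (hst : ∀ j k, s j ≠ t k) :
    ENNReal.ofReal ‖(n : ℂ)⁻¹ * ∑ j, ∑ k, Q j k * chordSlope h (s j) (t k)‖ ≤
      bilinNorm (triple (sigmaFun h) U U U) := by
  let phase (θ : ℝ) : ℂ := (√n : ℂ)⁻¹ * Complex.exp ((θ / 2 : ℝ) * Complex.I)
  have norm_phase (θ : ℝ) : ‖phase θ‖ = (√n)⁻¹ := by
    rw [norm_mul, Complex.norm_exp_ofReal_mul_I, mul_one, norm_inv, Complex.norm_real,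
      Real.norm_of_nonneg (Real.sqrt_nonneg _)]
  have phase_mul (θ θ' : ℝ) : phase θ * phase θ' =
      (n : ℂ)⁻¹ * Complex.exp (((θ + θ') / 2 : ℝ) * Complex.I) := by
    rw [mul_mul_mul_comm, ← Complex.exp_add, ← mul_inv, ← Complex.ofReal_mul,
      Real.mul_self_sqrt n.cast_nonneg, Complex.ofReal_natCast]
    congr 2
    push_cast
    ring
  have ortho_f := b.orthonormal.comp f f.injective
  have ortho_g := b.orthonormal.comp g g.injective
  let x := ∑ j, phase (s j) • b (f j)
  let y := ∑ k, (starRingEnd ℂ) (phase (t k)) • b (g k)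
  have inner_x (j : Fin n) : ⟪b (f j), x⟫_ℂ = phase (s j) := ortho_f.inner_right_fintype _ j
  have inner_y (k : Fin n) : ⟪y, b (g k)⟫_ℂ = phase (t k) :=
    (ortho_g.inner_left_fintype _ k).trans (Complex.conj_conj _)
  have norm_x : ‖x‖ ≤ 1 := norm_sum_smul_le_one ortho_f fun j => (norm_phase (s j)).le
  have norm_y : ‖y‖ ≤ 1 :=
    norm_sum_smul_le_one ortho_g fun k => ((RCLike.norm_conj _).trans (norm_phase (t k))).le
  have term (j k : Fin n) : Q j k * (sigmaFun h (z (f j)) (z o) (z (g k)) *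
      (⟪b (f j), x⟫_ℂ * ⟪y, b (g k)⟫_ℂ)) =
        -Complex.I * ((n : ℂ)⁻¹ * (Q j k * chordSlope h (s j) (t k))) := by
    rw [inner_x, inner_y, phase_mul, ho, hf, hg]
    linear_combination Q j k * (n : ℂ)⁻¹ *
      exp_mul_sigmaFun_one h (hs j) (ht k) (hs₀ j) (ht₀ k) (hst j k)
  have bound := ofReal_norm_sum_matrix_mul_le_bilinNorm (sigmaFun h) hb hb hb hQ o f g norm_x norm_y
  simp only [term, ← Finset.mul_sum] at bound
  rwa [norm_mul (-Complex.I), norm_neg, Complex.norm_I, one_mul] at bound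

theorem exists_unitary_ofReal_norm_sum_chordSlope_le (hQ : ‖Q‖ ≤ 1)
    (hs : ∀ j, s j ∈ Set.Ioc (-Real.pi) Real.pi) (ht : ∀ k, t k ∈ Set.Ioc (-Real.pi) Real.pi)
    (hs₀ : ∀ j, s j ≠ 0) (ht₀ : ∀ k, t k ≠ 0) (hst : ∀ j k, s j ≠ t k) :
    ∃ U ∈ unitary (Op (2 * n + 1)),
      ENNReal.ofReal ‖(n : ℂ)⁻¹ * ∑ j, ∑ k, Q j k * chordSlope h (s j) (t k)‖ ≤
        bilinNorm (triple (sigmaFun h) U U U) := by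
  let index : Option (Fin n ⊕ Fin n) ≃ Fin (2 * n + 1) :=
    Fintype.equivFinOfCardEq (by simp [two_mul])
  let angle (i : Fin (2 * n + 1)) : ℝ := (index.symm i).elim 0 (Sum.elim s t)
  let f : Fin n ↪ Fin (2 * n + 1) :=
    (Function.Embedding.inl.trans Function.Embedding.some).trans index.toEmbedding
  let g : Fin n ↪ Fin (2 * n + 1) :=
    (Function.Embedding.inr.trans Function.Embedding.some).trans index.toEmbedding
  obtain ⟨U, hU, hUb⟩ := exists_unitary_apply_eq_smul
    (fun i => Complex.exp (angle i * Complex.I)) fun i => Complex.norm_exp_ofReal_mul_I _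
  refine ⟨U, hU, ofReal_norm_sum_chordSlope_le_bilinNorm h hUb (o := index none) (f := f) (g := g)
    ?_ (fun j => ?_) (fun k => ?_) hQ hs ht hs₀ ht₀ hst⟩
  · simp [angle]
  · simp [angle, f]
  · simp [angle, g]

end ChordSlope

theorem le_chordSlope {h : ℝ → ℝ} {s t δ : ℝ} (hδ : 0 ≤ δ) (hpos : 0 < s - t)
    (hlt : s - t < 2 * Real.pi) (hh : δ * (s - t) ≤ h s - h t) : δ ≤ chordSlope h s t := by
  have sin_pos : 0 < Real.sin ((s - t) / 2) :=
    Real.sin_pos_of_pos_of_lt_pi (half_pos hpos) (by linarith)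
  rw [chordSlope, le_div_iff₀ (by positivity)]
  calc δ * (2 * Real.sin ((s - t) / 2)) ≤ δ * (2 * ((s - t) / 2)) := by
        gcongr
        exact Real.sin_le (by linarith)
    _ = δ * (s - t) := by ring
    _ ≤ h s - h t := hh

theorem chordSlope_le_neg {h : ℝ → ℝ} {s t δ : ℝ} (hδ : 0 ≤ δ) (hpos : 0 < s - t)
    (hlt : s - t < 2 * Real.pi) (hh : δ * (s - t) ≤ h t - h s) : chordSlope h s t ≤ -δ := by
  have neg_slope : chordSlope (-h) s t = -chordSlope h s t := by
    simp only [chordSlope, Pi.neg_apply]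
    ring
  have := le_chordSlope (h := -h) hδ hpos hlt (by simpa [neg_add_eq_sub] using hh)
  linarith

theorem exists_unitary_ofReal_mul_log_le_bilinNorm {h : ℝ → ℝ} {n : ℕ} {δ : ℝ} (hδ : 0 ≤ δ)
    {a : Fin n → ℝ} (ha : ∀ j, a j ∈ Set.Ioo 0 Real.pi)
    (hpos : ∀ j k, j < k → δ * (a j + a k) ≤ h (a j) - h (-a k))
    (hneg : ∀ j k, j < k → δ * (a j + a k) ≤ h (-a j) - h (a k)) :
    ∃ U ∈ unitary (Op (2 * n + 1)),
      ENNReal.ofReal (δ / Real.pi * Real.log n) ≤ bilinNorm (triple (sigmaFun h) U U U) := by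
  obtain ⟨U, hU, bound⟩ := exists_unitary_ofReal_norm_sum_chordSlope_le h
    (norm_hilbertMatrix_le_one n) (s := a) (t := fun k => -a k)
    (fun j => ⟨by linarith [(ha j).1, Real.pi_pos], (ha j).2.le⟩)
    (fun k => ⟨neg_lt_neg (ha k).2, by linarith [(ha k).1, Real.pi_pos]⟩)
    (fun j => (ha j).1.ne') (fun k => neg_ne_zero.2 (ha k).1.ne')
    (fun j k => ((neg_neg_of_pos (ha k).1).trans (ha j).1).ne')
  have gap_pos (j k : Fin n) : 0 < a j - -a k := by linarith [(ha j).1, (ha k).1]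
  have gap_lt (j k : Fin n) : a j - -a k < 2 * Real.pi := by linarith [(ha j).2, (ha k).2]
  have lower := le_sum_hilbertMatrix_mul hδ (D := fun j k => chordSlope h (a j) (-a k))
    (fun j k hjk => le_chordSlope hδ (gap_pos j k) (gap_lt j k) (by
      simpa only [sub_neg_eq_add] using hpos j k hjk))
    (fun j k hkj => chordSlope_le_neg hδ (gap_pos j k) (gap_lt j k) (by
      simpa only [sub_neg_eq_add, add_comm (a k)] using hneg k j hkj))
  refine ⟨U, hU, le_trans (ENNReal.ofReal_le_ofReal ?_) bound⟩
  set S := ∑ j, ∑ k, hilbertMatrix n j k * chordSlope h (a j) (-a k) with hS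
  calc δ / Real.pi * Real.log n ≤ (n : ℝ)⁻¹ * (δ / Real.pi * (n * Real.log n)) := by
        rcases eq_or_ne n 0 with rfl | hn
        · simp
        · have : (n : ℝ) ≠ 0 := Nat.cast_ne_zero.2 hn
          exact le_of_eq (by field_simp)
    _ ≤ (n : ℝ)⁻¹ * S := by gcongr
    _ ≤ ‖((n : ℝ)⁻¹ * S : ℝ)‖ := le_abs_self _
    _ = _ := by rw [← Complex.norm_real, hS]; push_cast; rfl

/-- The arguments of the eigenvalues near `1`; they decrease so fast that the divided differences
of `h` between `node j` and `-node k` are comparable to `nodeSlope (min j k)`. -/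
def node (j : ℕ) : ℝ := Real.exp (-(j + 1))

/-- The quotient `h x / |x|` at `|x| = node j`. -/
def nodeSlope (j : ℕ) : ℝ := (√(Real.log (j + 2)))⁻¹

theorem node_pos (j : ℕ) : 0 < node j := Real.exp_pos _

theorem node_lt_one (j : ℕ) : node j < 1 :=
  Real.exp_lt_one_iff.2 (by linarith [j.cast_nonneg (α := ℝ)])

theorem tendsto_node : Filter.Tendsto node Filter.atTop (𝓝 0) :=
  Real.tendsto_exp_neg_atTop_nhds_zero.comp
    (Filter.tendsto_atTop_add_const_right _ 1 tendsto_natCast_atTop_atTop)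

theorem two_mul_node_le {j k : ℕ} (hjk : j < k) : 2 * node k ≤ node j := by
  have hjk' : (j : ℝ) + 1 ≤ k := by exact_mod_cast hjk
  calc 2 * node k ≤ Real.exp 1 * node k := by
        gcongr
        · exact (node_pos k).le
        · linarith [Real.add_one_le_exp (1 : ℝ)]
    _ = Real.exp (1 - (k + 1)) := by rw [node, ← Real.exp_add, sub_eq_add_neg]
    _ ≤ node j := Real.exp_le_exp.2 (by linarith)

theorem nodeSlope_nonneg (j : ℕ) : 0 ≤ nodeSlope j := inv_nonneg.2 (Real.sqrt_nonneg _)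

theorem nodeSlope_antitone : Antitone nodeSlope := by
  intro j k hjk
  have hlog : 0 < Real.log ((j : ℝ) + 2) := Real.log_pos (by linarith [j.cast_nonneg (α := ℝ)])
  exact inv_anti₀ (Real.sqrt_pos.2 hlog) (by gcongr)

theorem inv_sqrt_mul_log_le_nodeSlope (m : ℕ) {n : ℕ} (hn : 2 ≤ n) :
    (√((m + 2 : ℕ) * Real.log n))⁻¹ ≤ nodeSlope (m + n) := by
  have add_le_pow : m + n + 2 ≤ n ^ (m + 2) :=
    calc m + n + 2 = n + (m + 2) := by ring
      _ ≤ n * (m + 2) := Nat.add_le_mul hn (by omega)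
      _ ≤ n ^ (m + 2) := Nat.mul_le_pow (by omega) _
  have hlog : 0 < Real.log ((m + n : ℕ) + 2) :=
    Real.log_pos (by linarith [(m + n).cast_nonneg (α := ℝ)])
  refine inv_anti₀ (Real.sqrt_pos.2 hlog) (Real.sqrt_le_sqrt ?_)
  rw [← Real.log_pow]
  exact Real.log_le_log (by positivity) (by exact_mod_cast add_le_pow)

theorem hFormula_of_abs_eq_node {x : ℝ} {j : ℕ} (hx : |x| = node j) :
    hFormula x = node j * nodeSlope j := by
  have hx₀ : x ≠ 0 := abs_pos.1 (hx ▸ node_pos j)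
  have hlog : |Real.log (node j / Real.exp 1)| = j + 2 := by
    rw [node, ← Real.exp_sub, Real.log_exp, ← abs_neg, abs_of_nonneg] <;>
      linarith [j.cast_nonneg (α := ℝ)]
  have hlog_nonneg : 0 ≤ Real.log ((j : ℝ) + 2) :=
    Real.log_nonneg (by linarith [j.cast_nonneg (α := ℝ)])
  rw [hFormula, if_neg hx₀, hx, hlog, Real.rpow_neg hlog_nonneg, ← Real.sqrt_eq_rpow,
    nodeSlope]

theorem nodeSlope_div_three_mul_le {j k M : ℕ} (hjk : j < k) (hj : j ≤ M) :
    nodeSlope M / 3 * (node j + node k) ≤ node j * nodeSlope j - node k * nodeSlope k :=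
  calc nodeSlope M / 3 * (node j + node k) ≤ nodeSlope j / 3 * (node j + node k) := by
        have := node_pos j
        have := node_pos k
        gcongr
        exact nodeSlope_antitone hj
    _ ≤ nodeSlope j / 3 * (3 * (node j - node k)) := by
        have := nodeSlope_nonneg j
        gcongr
        linarith [two_mul_node_le hjk]
    _ = node j * nodeSlope j - node k * nodeSlope j := by ring
    _ ≤ node j * nodeSlope j - node k * nodeSlope k := by
        have := (node_pos k).le
        gcongr
        exact nodeSlope_antitone hjk.le

theorem IsPeriodicExtension.eventuallyEq_hFormula {h : ℝ → ℝ} (hh : IsPeriodicExtension h) :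
    h =ᶠ[𝓝[≠] 0] hFormula := by
  have e_inv_pos : 0 < (Real.exp 1)⁻¹ := inv_pos.2 (Real.exp_pos 1)
  exact (Filter.eventuallyEq_of_mem (Icc_mem_nhds (neg_lt_zero.2 e_inv_pos) e_inv_pos)
    hh.eq_formula).filter_mono nhdsWithin_le_nhds

theorem exists_forall_ge_apply_node {h : ℝ → ℝ} (hh : h =ᶠ[𝓝[≠] 0] hFormula) :
    ∃ m, ∀ i, m ≤ i → h (node i) = node i * nodeSlope i ∧ h (-node i) = node i * nodeSlope i := by
  have tendsto_pos : Filter.Tendsto node Filter.atTop (𝓝[≠] 0) :=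
    tendsto_nhdsWithin_iff.2 ⟨tendsto_node, .of_forall fun i => (node_pos i).ne'⟩
  have tendsto_neg : Filter.Tendsto (fun i => -node i) Filter.atTop (𝓝[≠] 0) :=
    tendsto_nhdsWithin_iff.2 ⟨by simpa using tendsto_node.neg,
      .of_forall fun i => neg_ne_zero.2 (node_pos i).ne'⟩
  obtain ⟨m, hm⟩ := Filter.eventually_atTop.1
    ((tendsto_pos.eventually hh).and (tendsto_neg.eventually hh))
  have abs_node (i : ℕ) : |node i| = node i := abs_of_pos (node_pos i)
  exact ⟨m, fun i hi => ⟨(hm i hi).1.trans (hFormula_of_abs_eq_node (abs_node i)),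
    (hm i hi).2.trans (hFormula_of_abs_eq_node ((abs_neg _).trans (abs_node i)))⟩⟩

theorem exists_unitary_ofReal_nodeSlope_mul_log_le_bilinNorm {h : ℝ → ℝ} {m : ℕ}
    (hm : ∀ i, m ≤ i → h (node i) = node i * nodeSlope i ∧ h (-node i) = node i * nodeSlope i)
    (n : ℕ) : ∃ U ∈ unitary (Op (2 * n + 1)),
      ENNReal.ofReal (nodeSlope (m + n) / 3 / Real.pi * Real.log n) ≤
        bilinNorm (triple (sigmaFun h) U U U) := by
  have gap (j k : Fin n) (hjk : j < k) := nodeSlope_div_three_mul_le (j := m + j) (k := m + k)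
    (M := m + n) (by simpa using hjk) (by omega)
  have h_node (j : Fin n) := hm (m + j) (Nat.le_add_right m j)
  refine exists_unitary_ofReal_mul_log_le_bilinNorm (a := fun j => node (m + j))
    (div_nonneg (nodeSlope_nonneg _) zero_le_three)
    (fun j => ⟨node_pos _, (node_lt_one _).trans (by linarith [Real.pi_gt_three])⟩)
    (fun j k hjk => ?_) (fun j k hjk => ?_)
  · rw [(h_node j).1, (h_node k).2]
    exact gap j k hjk
  · rw [(h_node j).2, (h_node k).1]
    exact gap j k hjk

theorem inv_mul_sqrt_log_le_nodeSlope_mul_log (m : ℕ) {n : ℕ} (hn : 2 ≤ n) :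
    (3 * Real.pi * √(m + 2 : ℕ))⁻¹ * √(Real.log n) ≤
      nodeSlope (m + n) / 3 / Real.pi * Real.log n :=
  calc (3 * Real.pi * √(m + 2 : ℕ))⁻¹ * √(Real.log n)
      = (√((m + 2 : ℕ) * Real.log n))⁻¹ / 3 / Real.pi * Real.log n := by
        rw [Real.sqrt_mul (Nat.cast_nonneg _)]
        conv_lhs => rw [← Real.div_sqrt (x := Real.log n)]
        ring
    _ ≤ nodeSlope (m + n) / 3 / Real.pi * Real.log n := by
        have := Real.log_natCast_nonneg n
        gcongr
        exact inv_sqrt_mul_log_le_nodeSlope m hn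

end TripleOperatorIntegral

end

open TripleOperatorIntegral in
theorem corollary4p5_general (h : ℝ → ℝ) (hh : h =ᶠ[𝓝[≠] 0] hFormula) :
    ∃ c : ℝ, 0 < c ∧ ∀ n : ℕ, 2 ≤ n →
      ∃ U ∈ unitary (Op (2 * n + 1)),
        ENNReal.ofReal (c * √(Real.log n)) ≤ bilinNorm (triple (sigmaFun h) U U U) := by
  obtain ⟨m, hm⟩ := exists_forall_ge_apply_node hh
  refine ⟨(3 * Real.pi * √(m + 2 : ℕ))⁻¹, by positivity, fun n hn => ?_⟩
  obtain ⟨U, hU, bound⟩ := exists_unitary_ofReal_nodeSlope_mul_log_le_bilinNorm hm n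
  exact ⟨U, hU, le_trans (ENNReal.ofReal_le_ofReal
    (inv_mul_sqrt_log_le_nodeSlope_mul_log m hn)) bound⟩

theorem corollary4p5 (h : ℝ → ℝ) (hh : TripleOperatorIntegral.IsPeriodicExtension h) :
    ∃ c : ℝ, 0 < c ∧ ∀ n : ℕ, 3 ≤ n →
      ∃ H K : TripleOperatorIntegral.Op (2 * n + 1),
        H ∈ unitary (TripleOperatorIntegral.Op (2 * n + 1)) ∧
        K ∈ unitary (TripleOperatorIntegral.Op (2 * n + 1)) ∧
        spectrum ℂ H = spectrum ℂ K ∧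
        ENNReal.ofReal (c * Real.sqrt (Real.log n)) ≤
          TripleOperatorIntegral.bilinNorm
            (TripleOperatorIntegral.triple (TripleOperatorIntegral.sigmaFun h) K H H) := by
  obtain ⟨c, hc, bound⟩ := corollary4p5_general h hh.eventuallyEq_hFormula
  exact ⟨c, hc, fun n hn => (bound n (by omega)).imp fun U hU => ⟨U, hU.1, hU.1, rfl, hU.2⟩⟩
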